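/- Let $r,k,m\ge 1$ be integers and $u_i=k+(i-1)r$ for $1\le i\le m$. Consider a one-way street with spots $1,\dots,u_m$. Cars $1,\dots,m$ enter one after the other; car $i$ drives to its preferred spot $\pi_i\in\{1,\dots,u_m\}$ and parks there if it is free. If it is taken, the car tosses a coin that shows heads with probability $p\in[0,1]$: on heads it moves forward, on tails backward, to the first free spot that it meets, and it leaves the street without parking if there is none. The coins are independent of each other and of the preferences, and the preference vector $\pi=(\pi_1,\dots,\pi_m)$ is uniform on $\{1,\dots,u_m\}^m$. Write $\pi\in\mathrm{PF}_m(r,k)$ for the event that all $m$ cars park and that, for every $1\le i\le m$, the $i$-th smallest of the spots parked in is at most $u_i$. (For $p=1$ this depends on $\pi$ only, and $\pi$ conditioned on it is a uniformly random $(r,k)$-parking function of length $m$.) Let $U(\pi)$ be the number of unlucky cars, i.e. cars that do not park at their preferred spot, and let $R(\pi)$ be the number of repeats, i.e. of indices $2\le i\le m$ with $\pi_i=\pi_{i-1}$. Proposition. Fix $p\in[0,1]$, an integer $r\ge1$ and a real number $c\ge0$. Let $m\to\infty$ along positive integers $m$ for which $k=cm+r$ is an integer. Then for every fixed $j=0,1,2,\dots$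 $$\mathbb P\bigl(R(\pi)=j\mid \pi\in \mathrm{PF}_m(r,k)\bigr)\longrightarrow \frac{\left(\frac1{c+r}\right)^j e^{-\frac1{c+r}}}{j!},$$ and for every fixed $x\in\mathbb R$ $$\mathbb P\left(\frac{U(\pi)-\frac{1}{2(c+r)}m}{\sqrt{\frac{3(c+r)-2}{6(c+r)^2}m}}\le x\;\middle|\;\pi\in\mathrm{PF}_m(r,k)\right)\longrightarrow\Phi(x),$$ where $\Phi$ is the standard normal distribution function. -/

import Mathlib

open MeasureTheory ProbabilityTheory Filter Topology

namespace RKParking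

/-- The bounds `u_i = k + (i - 1) r`, `1 ≤ i ≤ m`; here `i` is shifted to start from `0`. -/
def bound (r k i : ℕ) : ℕ := k + i * r

/-- The number `u_m = k + (m - 1) r` of spots on the street (for `m ≥ 1` cars). -/
def streetLength (r k m : ℕ) : ℕ := k + (m - 1) * r

/-- The data of one run: the preferred spot of every car, and for every car the side on which
its coin falls if it has to be tossed (`true` is heads). The spots `1, …, N` are the elements
of `Fin N`, so that `s : Fin N` is spot number `s + 1`. -/
abbrev Run (m N : ℕ) : Type := (Fin m → Fin N) × (Fin m → Bool)

/-- The first free spot after `a`, if there is one. -/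
def nextFree {N : ℕ} (occ : Finset (Fin N)) (a : Fin N) : Option (Fin N) :=
  if h : (Finset.univ.filter fun s => a < s ∧ s ∉ occ).Nonempty then
    some ((Finset.univ.filter fun s => a < s ∧ s ∉ occ).min' h)
  else none

/-- The last free spot before `a`, if there is one. -/
def prevFree {N : ℕ} (occ : Finset (Fin N)) (a : Fin N) : Option (Fin N) :=
  if h : (Finset.univ.filter fun s => s < a ∧ s ∉ occ).Nonempty then
    some ((Finset.univ.filter fun s => s < a ∧ s ∉ occ).max' h)
  else none

/-- Where a car with preference `a` parks when the spots in `occ` are taken: at `a` if `a` is free;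
otherwise it moves forward (heads) or backward (tails) to the first free spot that it meets.
`none` means that it leaves the street without parking. -/
def parkSpot {N : ℕ} (occ : Finset (Fin N)) (a : Fin N) (heads : Bool) : Option (Fin N) :=
  if a ∉ occ then some a
  else if heads then nextFree occ a
  else prevFree occ a

/-- The set of spots that are taken after the first `i` cars have entered. -/
def occupied {m N : ℕ} (ω : Run m N) : ℕ → Finset (Fin N)
  | 0 => ∅
  | i + 1 =>
    if h : i < m then
      occupied ω i ∪ (parkSpot (occupied ω i) (ω.1 ⟨i, h⟩) (ω.2 ⟨i, h⟩)).toFinset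
    else occupied ω i

/-- The spot where car `i` parks, if it parks. -/
def outcome {m N : ℕ} (ω : Run m N) (i : Fin m) : Option (Fin N) :=
  parkSpot (occupied ω i) (ω.1 i) (ω.2 i)

/-- The event `π ∈ PF_m(r, k)`: all `m` cars park, and the `i`-th of the spots parked in, read from
left to right, is at most `u_i`, for `1 ≤ i ≤ m`. -/
def parkingEvent (r k m : ℕ) : Set (Run m (streetLength r k m)) :=
  {ω | ∃ h : (occupied ω m).card = m,
    ∀ i : Fin m, ((occupied ω m).orderEmbOfFin h i : ℕ) + 1 ≤ bound r k i}

/-- The number of unlucky cars: those that do not park at their preferred spot. -/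
def unlucky {m N : ℕ} (ω : Run m N) : ℕ :=
  (Finset.univ.filter fun i : Fin m => outcome ω i ≠ some (ω.1 i)).card

/-- The number of repeats: cars whose preference is that of the previous car. -/
def repeats {m N : ℕ} (ω : Run m N) : ℕ :=
  (Finset.univ.filter fun i : Fin m => ∃ j : Fin m, (j : ℕ) + 1 = i ∧ ω.1 j = ω.1 i).card

/-- The law of a run: the preference vector is uniform, the coins are independent of it and of each
other, and each shows heads with probability `p`. -/
noncomputable def runLaw (p : unitInterval) (m N : ℕ) : Measure (Run m N) :=
  (uniformOn (Set.univ : Set (Fin m → Fin N))).prod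
    (Measure.pi fun _ : Fin m => bernoulliMeasure true false p)

/-- The law of a run, conditioned on `π ∈ PF_m(r, k)`. -/
noncomputable def parkingLaw (p : unitInterval) (r k m : ℕ) :
    Measure (Run m (streetLength r k m)) :=
  ProbabilityTheory.cond (runLaw p m (streetLength r k m)) (parkingEvent r k m)

end RKParking

/-! Close the street to a circle `ZMod M` with `M = k + m r` spots by adding `r` spots after the
last one. On the circle every car parks, whatever the coins, and rotating the preferences rotates
the whole process. The parking event becomes a condition on the final set of taken spots alone: for
`1 ≤ t ≤ M`, the last `t` spots before the cut hold fewer than `t / r` cars (`SparseEnds`,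
`mem_parkingEvent_iff`). By the cycle lemma exactly `k` of the `M` rotations of a set of `m` spots
satisfy it (`card_rotations_sparseEnds`). Hence a rotation-invariant statistic whose law on the
circle does not depend on the coins has the same law given the parking event as on the circle with
uniform preferences (`parkingLaw_real_eq`).

On the circle, with `i` cars parked, the next one is unlucky for exactly `i` of its `M` preferences,
whatever the past and the coins. So the number of unlucky cars is a sum of independent Bernoulli
variables with parameters `i / M`, `i < m`, and the number of repeats is binomial with parameters `m
- 1` and `1 / M` (`sum_pow_hits`). Since `M = (c + r) m + r`, the repeats have a Poisson limit with
mean `1 / (c + r)`, and the unlucky cars satisfy a central limit theorem, proved by characteristic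
functions. -/

namespace RKParking

/-! ### Adaptive targets of prescribed sizes -/

/-- The first `i` entries of a vector of length `n`. -/
def initial {α : Type*} {n : ℕ} (π : Fin n → α) (i : ℕ) (h : i ≤ n) : Fin i → α :=
  fun j => π (j.castLE h)

@[simp] lemma initial_self {α : Type*} {n : ℕ} (π : Fin n → α) (h : n ≤ n) :
    initial π n h = π := rfl

lemma init_initial {α : Type*} {n : ℕ} (π : Fin n → α) (i : ℕ) (h : i + 1 ≤ n) :
    Fin.init (initial π (i + 1) h) = initial π i (Nat.le_of_succ_le h) := rfl

lemma initial_init {α : Type*} {n : ℕ} (π : Fin (n + 1) → α) (i : ℕ) (h : i ≤ n) :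
    initial (Fin.init π) i h = initial π i (h.trans n.le_succ) := rfl

/-- The number of entries of `π` that lie in a set determined by the previous entries. -/
def hits {α : Type*} [DecidableEq α] (A : (n : ℕ) → (Fin n → α) → Finset α) {n : ℕ}
    (π : Fin n → α) : ℕ :=
  (Finset.univ.filter fun i : Fin n => π i ∈ A i (initial π i i.isLt.le)).card

lemma hits_succ {α : Type*} [DecidableEq α] (A : (n : ℕ) → (Fin n → α) → Finset α) {n : ℕ}
    (π : Fin (n + 1) → α) :
    hits A π = hits A (Fin.init π) +
      if π (Fin.last n) ∈ A n (Fin.init π) then 1 else 0 := by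
  simp only [hits, Finset.card_filter]
  rw [Fin.sum_univ_castSucc]
  rfl

lemma hits_le {α : Type*} [DecidableEq α] (A : (n : ℕ) → (Fin n → α) → Finset α) {n : ℕ}
    (π : Fin n → α) : hits A π ≤ n := by
  simpa [hits] using Finset.card_filter_le (Finset.univ : Finset (Fin n)) _

/-- The generating function of the number of hits, when the sizes of the target sets are known. -/
lemma sum_pow_hits {α R : Type*} [Fintype α] [DecidableEq α] [CommRing R]
    (A : (n : ℕ) → (Fin n → α) → Finset α) (a : ℕ → ℕ) (n : ℕ)
    (hA : ∀ i < n, ∀ π : Fin i → α, (A i π).card = a i) (x : R) :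
    ∑ π : Fin n → α, x ^ hits A π =
      ∏ i ∈ Finset.range n, ((Fintype.card α : R) - a i + a i * x) := by
  induction n with
  | zero => simp [hits]
  | succ n ih =>
    rw [Finset.prod_range_succ, ← ih fun i hi => hA i (by omega),
      ← (Fin.snocEquiv fun _ => α).sum_comp, Fintype.sum_prod_type_right, Finset.sum_mul]
    refine Finset.sum_congr rfl fun π _ => ?_
    -- Exactly `a n` values of the last entry hit, whatever the previous entries are, so summing
    -- over `y` yields the factor `card α + a n * (x - 1)`.
    have h : ∀ y : α, x ^ hits A ((Fin.snocEquiv fun _ => α) (y, π)) =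
        x ^ hits A π * (1 + if y ∈ A n π then x - 1 else 0) := by
      intro y
      rw [hits_succ]
      have h1 : Fin.init ((Fin.snocEquiv fun _ => α) (y, π)) = π := by
        simp [Fin.snocEquiv]
      have h2 : ((Fin.snocEquiv fun _ => α) (y, π)) (Fin.last n) = y := by
        simp [Fin.snocEquiv]
      rw [h1, h2]
      split_ifs <;> simp [pow_succ]
    simp_rw [h]
    rw [← Finset.mul_sum, Finset.sum_add_distrib, Finset.sum_ite_mem]
    simp [hA n (by omega)]
    ring

/-- The number of vectors with a given number of hits depends only on the sizes of the targets. -/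
lemma card_hits_eq {α : Type*} [Fintype α] [DecidableEq α]
    (A : (n : ℕ) → (Fin n → α) → Finset α) (a : ℕ → ℕ) (n : ℕ)
    (hA : ∀ i < n, ∀ π : Fin i → α, (A i π).card = a i) (j : ℕ) :
    ((Finset.univ.filter fun π : Fin n → α => hits A π = j).card : ℤ) =
      (∏ i ∈ Finset.range n, ((Fintype.card α : Polynomial ℤ) - (a i : Polynomial ℤ) + (a i : Polynomial ℤ) * Polynomial.X)).coeff
        j := by
  rw [← sum_pow_hits A a n hA, Polynomial.finsetSum_coeff, Finset.card_filter]
  simp [Polynomial.coeff_X_pow, eq_comm]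

/-- The set of the last entry. -/
def lastEntry {α : Type*} : (n : ℕ) → (Fin n → α) → Finset α
  | 0, _ => ∅
  | n + 1, π => {π (Fin.last n)}

/-! ### Parking on a circular street -/

/-- The side of the street on which a car looks for a free spot. -/
def side {M : ℕ} (heads : Bool) : ZMod M := if heads then 1 else -1

/-- The spot where a car parks on a circular street. -/
noncomputable def circSpot {M : ℕ} (occ : Finset (ZMod M)) (a : ZMod M) (heads : Bool) : ZMod M :=
  a + ((sInf {t : ℕ | a + (t : ZMod M) * side heads ∉ occ} : ℕ) : ZMod M) * side heads

/-- The set of the spots taken on a circular street. -/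
noncomputable def circOccupied {M : ℕ} (b : ℕ → Bool) : (n : ℕ) → (Fin n → ZMod M) →
    Finset (ZMod M)
  | 0, _ => ∅
  | n + 1, π => insert (circSpot (circOccupied b n (Fin.init π)) (π (Fin.last n)) (b n))
      (circOccupied b n (Fin.init π))

lemma circSpot_eq {M : ℕ} {occ : Finset (ZMod M)} {a : ZMod M} {heads : Bool} (t : ℕ)
    (ht : a + (t : ZMod M) * side heads ∉ occ) (h : ∀ u < t, a + (u : ZMod M) * side heads ∈ occ) :
    circSpot occ a heads = a + (t : ZMod M) * side heads := by
  have : sInf {t : ℕ | a + (t : ZMod M) * side heads ∉ occ} = t := by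
    refine le_antisymm (Nat.sInf_le ht) ?_
    by_contra! hlt
    exact Nat.sInf_mem (s := {t : ℕ | a + (t : ZMod M) * side heads ∉ occ}) ⟨t, ht⟩ (h _ hlt)
  rw [circSpot, this]

/-- The search visits every spot of the circle, so it succeeds unless the circle is full. This rules
out the default value `0` of `sInf` on the empty set. -/
lemma circSpot_notMem {M : ℕ} [NeZero M] {occ : Finset (ZMod M)} (hocc : occ.card < M)
    (a : ZMod M) (heads : Bool) : circSpot occ a heads ∉ occ := by
  have hne : {t : ℕ | a + (t : ZMod M) * side heads ∉ occ}.Nonempty := by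
    by_contra! hemp
    have hall : ∀ x : ZMod M, x ∈ occ := by
      intro x
      -- As `side heads` squares to `1`, this number of steps leads from `a` to `x`.
      have h : ((x - a) * side heads).val ∉ {t : ℕ | a + (t : ZMod M) * side heads ∉ occ} := by
        simp [hemp]
      simp only [Set.mem_ofPred_eq, not_not, ZMod.natCast_val, ZMod.cast_id', id] at h
      convert h using 1
      cases heads <;> simp [side]
    have : occ = Finset.univ := Finset.eq_univ_iff_forall.2 hall
    rw [this, Finset.card_univ, ZMod.card] at hocc
    omega
  exact Nat.sInf_mem hne

lemma card_circOccupied {M : ℕ} [NeZero M] (b : ℕ → Bool) (n : ℕ) (hn : n ≤ M)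
    (π : Fin n → ZMod M) : (circOccupied b n π).card = n := by
  induction n with
  | zero => rfl
  | succ n ih =>
    have h := ih (by omega) (Fin.init π)
    rw [circOccupied, Finset.card_insert_of_notMem (circSpot_notMem (by omega) _ _), h]

lemma circOccupied_initial_subset {M : ℕ} (b : ℕ → Bool) {n : ℕ} (π : Fin n → ZMod M) (i : ℕ)
    (h : i ≤ n) : circOccupied b i (initial π i h) ⊆ circOccupied b n π := by
  induction n with
  | zero => obtain rfl : i = 0 := by omega
            exact subset_rfl
  | succ n ih =>
    rcases h.eq_or_lt with rfl | hlt
    · exact subset_rfl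
    · have := ih (Fin.init π) (by omega)
      rw [initial_init] at this
      exact this.trans (Finset.subset_insert _ _)

/-- A preference is either taken already or becomes taken by the car itself. Thus control of the
final set controls the preferences. -/
lemma mem_circOccupied {M : ℕ} (b : ℕ → Bool) {n : ℕ} (π : Fin n → ZMod M) (i : Fin n) :
    π i ∈ circOccupied b n π := by
  apply circOccupied_initial_subset b π (i + 1) i.isLt
  by_cases h : π i ∈ circOccupied b i (initial π i i.isLt.le)
  · exact Finset.mem_insert_of_mem h
  · have h0 := circSpot_eq (a := π i) (heads := b i) 0 (by simpa using h) (by simp)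
    simp only [Nat.cast_zero, zero_mul, add_zero] at h0
    exact Finset.mem_insert.2 (Or.inl h0.symm)

lemma circSpot_map_add {M : ℕ} (c : ZMod M) (occ : Finset (ZMod M)) (a : ZMod M) (heads : Bool) :
    circSpot (occ.map (addRightEmbedding c)) (a + c) heads = circSpot occ a heads + c := by
  have : ∀ x : ZMod M, a + c + x ∈ occ.map (addRightEmbedding c) ↔ a + x ∈ occ := by
    intro x
    rw [show a + c + x = addRightEmbedding c (a + x) by simp; ring, Finset.mem_map']
  simp only [circSpot, this]
  ring

lemma circOccupied_add {M : ℕ} (c : ZMod M) (b : ℕ → Bool) (n : ℕ) (π : Fin n → ZMod M) :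
    circOccupied b n (fun i => π i + c) = (circOccupied b n π).map (addRightEmbedding c) := by
  induction n with
  | zero => rfl
  | succ n ih =>
    have h := ih (Fin.init π)
    have h' : Fin.init (fun i => π i + c) = fun i => Fin.init π i + c := rfl
    rw [circOccupied, circOccupied, Finset.map_insert, h', h, circSpot_map_add]
    rfl

lemma hits_circOccupied_add {M : ℕ} (c : ZMod M) (b : ℕ → Bool) (n : ℕ) (π : Fin n → ZMod M) :
    hits (circOccupied b) (fun i => π i + c) = hits (circOccupied b) π := by
  have h' (i : ℕ) (hi : i ≤ n) : initial (fun i => π i + c) i hi =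
    fun j => initial π i hi j + c := rfl
  simp only [hits, h', circOccupied_add]
  simp

lemma hits_lastEntry_add {M : ℕ} (c : ZMod M) (n : ℕ) (π : Fin n → ZMod M) :
    hits lastEntry (fun i => π i + c) = hits lastEntry π := by
  have h (i : ℕ) (π : Fin i → ZMod M) :
      lastEntry i (fun i => π i + c) = (lastEntry i π).map (addRightEmbedding c) := by
    cases i <;> simp [lastEntry]
  have h' (i : ℕ) (hi : i ≤ n) : initial (fun i => π i + c) i hi =
    fun j => initial π i hi j + c := rfl
  simp only [hits, h', h]
  simp

/-! ### The cycle lemma and rotations -/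

open Classical in
/-- **Cycle lemma** for integer walks with down-steps of size at most one. -/
lemma card_strict_future_max (f : ℕ → ℤ) (M k : ℕ) (hM : 0 < M) (hk : 0 < k)
    (hstep : ∀ t, f t - 1 ≤ f (t + 1)) (hper : ∀ t, f (t + M) = f t - k) :
    ((Finset.range M).filter fun c => ∀ t, 1 ≤ t → t ≤ M → f (c + t) < f c).card = k := by
  have hne : (Finset.range M).Nonempty := ⟨0, by simpa⟩
  -- By the negative drift per period, `F c` is the maximum of `f` from `c` onwards. It drops by `k`
  -- over a period, and the count is obtained by telescoping.
  set F : ℕ → ℤ := fun c => (Finset.range M).sup' hne fun t => f (c + t) with hF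
  have hle (c t : ℕ) (ht : t < M) : f (c + t) ≤ F c :=
    Finset.le_sup' (fun t => f (c + t)) (Finset.mem_range.2 ht)
  have hFM : F M = F 0 - k := by
    have h1 : F M ≤ F 0 - k := by
      refine Finset.sup'_le _ _ fun t ht => ?_
      have := hle 0 t (Finset.mem_range.1 ht)
      have h2 := hper t
      rw [add_comm M t]; simp only [zero_add] at this; omega
    have h3 : F 0 ≤ F M + k := by
      refine Finset.sup'_le _ _ fun t ht => ?_
      have := hle M t (Finset.mem_range.1 ht)
      have h2 := hper t
      rw [add_comm M t] at this; simp only [zero_add]; omega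
    omega
  -- If `c` is a strict future maximum, `F` drops from `f c` to a smaller value, which is at least
  -- `f (c + 1) ≥ f c - 1`. Otherwise the value `f c` is reached or exceeded later, and `F` does not
  -- drop.
  have hdiff (c : ℕ) : F c - F (c + 1) =
      if ∀ t, 1 ≤ t → t ≤ M → f (c + t) < f c then 1 else 0 := by
    obtain ⟨u, hu, hFu⟩ := Finset.exists_mem_eq_sup' hne fun t => f (c + t)
    obtain ⟨v, hv, hFv⟩ := Finset.exists_mem_eq_sup' hne fun t => f (c + 1 + t)
    change F c = f (c + u) at hFu
    change F (c + 1) = f (c + 1 + v) at hFv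
    rw [Finset.mem_range] at hu hv
    have h0 : f c ≤ F c := hle c 0 hM
    have h1 : f c - 1 ≤ F (c + 1) := (hstep c).trans (hle (c + 1) 0 hM)
    have hnext (t : ℕ) (ht : 1 ≤ t) (ht' : t ≤ M) : f (c + t) ≤ F (c + 1) := by
      have := hle (c + 1) (t - 1) (by omega)
      rwa [show c + 1 + (t - 1) = c + t by omega] at this
    have hmax : F c = f c ∨ F c ≤ F (c + 1) := by
      rcases Nat.eq_zero_or_pos u with rfl | hpos
      · exact Or.inl hFu
      · right; rw [hFu]; exact hnext u hpos hu.le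
    have hprev : F (c + 1) ≤ F c := by
      rcases Nat.lt_or_ge (v + 1) M with hlt | hge
      · have := hle c (v + 1) hlt
        rw [hFv, show c + 1 + v = c + (v + 1) by omega]; exact this
      · rw [hFv, show c + 1 + v = c + M by omega, hper]; omega
    split_ifs with hg
    · have h2 := hg (v + 1) (by omega) (by omega)
      rw [show c + (v + 1) = c + 1 + v by omega, ← hFv] at h2
      omega
    · push Not at hg
      obtain ⟨t, ht, ht', hft⟩ := hg
      have := hnext t ht ht'
      omega
  have hsum := Finset.sum_range_sub' F M
  simp_rw [hdiff] at hsum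
  have hk' : F 0 - F M = k := by rw [hFM]; ring
  rw [hk'] at hsum
  rw [Finset.card_filter]
  zify
  convert hsum <;> omega

/-- In each final stretch of the circular street, cut between `-1` and `0`, the proportion of the
spots in `O` is less than `1 / r`. -/
def SparseEnds {M : ℕ} (r : ℕ) (O : Finset (ZMod M)) : Prop :=
  ∀ t : ℕ, 1 ≤ t → t ≤ M →
    r * ((Finset.range t).filter fun i : ℕ => (-1 - (i : ZMod M)) ∈ O).card < t

lemma sum_range_natCast {M : ℕ} [NeZero M] {β : Type*} [AddCommMonoid β] (f : ZMod M → β) :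
    ∑ i ∈ Finset.range M, f (i : ZMod M) = ∑ x, f x := by
  refine Finset.sum_bij' (fun i _ => (i : ZMod M)) (fun x _ => x.val) ?_ ?_ ?_ ?_ ?_
  · simp
  · intro x _; simpa using x.val_lt
  · intro i hi; exact ZMod.val_cast_of_lt (Finset.mem_range.1 hi)
  · simp
  · simp

open Classical in
/-- A set of `m` spots has exactly `k` rotations with sparse ends. -/
lemma card_rotations_sparseEnds {M : ℕ} [NeZero M] (r k : ℕ) (hk : 0 < k) (O : Finset (ZMod M))
    (hO : k + O.card * r = M) :
    (Finset.univ.filter fun c : ZMod M => SparseEnds r (O.map (addRightEmbedding c))).card = k := by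
  set g : ℕ → ℤ := fun i => if (-1 - (i : ZMod M)) ∈ O then 1 else 0 with hg
  -- The walk reads the circle backwards from `-1`: each spot costs `1` and each car on it pays `r`.
  -- One turn changes it by `r * O.card - M = -k`.
  set f : ℕ → ℤ := fun t => r * ∑ i ∈ Finset.range t, g i - t with hf
  have hstep (t : ℕ) : f t - 1 ≤ f (t + 1) := by
    have : 0 ≤ (r : ℤ) * g t := by simp only [hg]; positivity
    simp only [hf, Finset.sum_range_succ]; push_cast; linarith
  have hper (t : ℕ) : f (t + M) = f t - k := by
    have h1 : ∑ i ∈ Finset.range M, g (t + i) = O.card := by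
      have := sum_range_natCast (M := M)
        (fun x : ZMod M => if (-1 - ((t : ZMod M) + x)) ∈ O then (1 : ℤ) else 0)
      simp only [hg]; push_cast; rw [this]
      rw [Fintype.sum_equiv (Equiv.subLeft (-1 - (t : ZMod M))) _
        (fun x => if x ∈ O then (1 : ℤ) else 0) fun x => by simp [sub_sub]]
      simp
    simp only [hf, Finset.sum_range_add, h1]
    have hO' : (M : ℤ) = k + O.card * r := by exact_mod_cast hO.symm
    push_cast; linarith
  have h := card_strict_future_max f M k (NeZero.pos M) hk hstep hper
  rw [← h, eq_comm, Finset.card_filter, Finset.card_filter]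
  rw [← sum_range_natCast (M := M) fun c : ZMod M =>
    if SparseEnds r (O.map (addRightEmbedding c)) then 1 else 0]
  refine Finset.sum_congr rfl fun c _ => ?_
  congr 1
  refine propext (forall_congr' fun t => forall_congr' fun _ => forall_congr' fun _ => ?_)
  -- Rotating by `c` makes the reading start at time `c`, so sparse ends mean that `c` is a strict
  -- future maximum of `f`.
  have hmem (i : ℕ) : (-1 - (i : ZMod M)) ∈ O.map (addRightEmbedding (c : ZMod M)) ↔
      (-1 - ((c + i : ℕ) : ZMod M)) ∈ O := by
    rw [show (-1 - (i : ZMod M)) = addRightEmbedding (c : ZMod M) (-1 - ((c + i : ℕ) : ZMod M)) by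
      simp; ring, Finset.mem_map']
  simp only [hmem, hf, Finset.sum_range_add, Finset.card_filter]
  simp only [hg]
  zify
  constructor <;> intro h <;> linarith

open Classical in
/-- Among the rotations of a family of preferences a fraction of `k / M` has sparse ends. -/
lemma card_sparseEnds {M : ℕ} [NeZero M] (r k m : ℕ) (hk : 0 < k) (hmM : m ≤ M)
    (hM : k + m * r = M) (b : ℕ → Bool) (P : (Fin m → ZMod M) → Prop)
    (hP : ∀ π c, P (fun i => π i + c) ↔ P π) :
    M * (Finset.univ.filter fun π : Fin m → ZMod M =>
        SparseEnds r (circOccupied b m π) ∧ P π).card =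
      k * (Finset.univ.filter fun π : Fin m → ZMod M => P π).card := by
  -- The pairs of preferences and rotations are counted twice: each `π` has `k` good rotations, and
  -- each `c` permutes the preferences while preserving `P`.
  have h1 (π : Fin m → ZMod M) : (∑ c : ZMod M,
      if SparseEnds r (circOccupied b m (fun i => π i + c)) then 1 else 0) = k := by
    simp_rw [circOccupied_add]
    rw [← Finset.card_filter]
    exact card_rotations_sparseEnds r k hk _ (by rw [card_circOccupied b m hmM, hM])
  have h2 (c : ZMod M) : (Finset.univ.filter fun π : Fin m → ZMod M =>
        SparseEnds r (circOccupied b m π) ∧ P π).card =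
      ∑ π : Fin m → ZMod M, if P π then
        (if SparseEnds r (circOccupied b m (fun i => π i + c)) then 1 else 0) else 0 := by
    rw [Finset.card_filter, ← Equiv.sum_comp (Equiv.addRight (fun _ : Fin m => c))]
    refine Finset.sum_congr rfl fun π _ => ?_
    have h3 : (Equiv.addRight (fun _ : Fin m => c)) π = fun i => π i + c := rfl
    rw [h3, hP, ← ite_and]
    simp only [and_comm]
  calc _ = ∑ c : ZMod M, ∑ π : Fin m → ZMod M, (if P π then
        (if SparseEnds r (circOccupied b m (fun i => π i + c)) then 1 else 0) else 0) := by
        rw [Finset.sum_congr rfl fun c _ => (h2 c).symm]; simp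
    _ = _ := by
        rw [Finset.sum_comm, Finset.card_filter, Finset.mul_sum]
        refine Finset.sum_congr rfl fun π _ => ?_
        split_ifs with h
        · rw [h1, mul_one]
        · simp

/-! ### Comparison of the street with the circle -/

/-- The street as a stretch of the circular street. -/
def toCirc {N M : ℕ} (h : N ≤ M) : Fin N ↪ ZMod M where
  toFun s := (s : ℕ)
  inj' s t hst := by
    have := congrArg ZMod.val hst
    simp only at this
    rw [ZMod.val_cast_of_lt (by omega), ZMod.val_cast_of_lt (by omega)] at this
    exact Fin.ext this

lemma toCirc_apply {N M : ℕ} (h : N ≤ M) (s : Fin N) : toCirc h s = ((s : ℕ) : ZMod M) := rfl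

lemma natCast_mem_map_toCirc {N M : ℕ} (h : N ≤ M) (occ : Finset (Fin N)) {n : ℕ} (hn : n < N) :
    (n : ZMod M) ∈ occ.map (toCirc h) ↔ ⟨n, hn⟩ ∈ occ := by
  rw [← Finset.mem_map' (toCirc h) (a := ⟨n, hn⟩)]; rfl

lemma natCast_notMem_range_toCirc {N M : ℕ} (h : N ≤ M) {n : ℕ} (hn : N ≤ n) (hnM : n < M) :
    (n : ZMod M) ∉ Set.range (toCirc h) := by
  rintro ⟨s, hs⟩
  have := congrArg ZMod.val hs
  rw [toCirc_apply, ZMod.val_cast_of_lt (by omega), ZMod.val_cast_of_lt hnM] at this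
  omega

lemma map_toCirc_subset_range {N M : ℕ} (h : N ≤ M) (occ : Finset (Fin N)) {x : ZMod M}
    (hx : x ∈ occ.map (toCirc h)) : x ∈ Set.range (toCirc h) := by
  obtain ⟨s, -, hs⟩ := Finset.mem_map.1 hx
  exact ⟨s, hs⟩

lemma mem_of_nextFree_eq_some {N : ℕ} {occ : Finset (Fin N)} {a s : Fin N}
    (h : nextFree occ a = some s) :
    a < s ∧ s ∉ occ ∧ ∀ x, a < x → x < s → x ∈ occ := by
  unfold nextFree at h
  split_ifs at h with hne
  have hs := Option.some_injective _ h
  have hmem := Finset.min'_mem _ hne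
  rw [hs] at hmem
  simp only [Finset.mem_filter, Finset.mem_univ, true_and] at hmem
  refine ⟨hmem.1, hmem.2, fun x hax hxs => ?_⟩
  by_contra hx
  have := Finset.min'_le (Finset.univ.filter fun s => a < s ∧ s ∉ occ) x (by simp [hax, hx])
  rw [hs] at this
  exact absurd hxs (not_lt.2 this)

lemma mem_of_nextFree_eq_none {N : ℕ} {occ : Finset (Fin N)} {a : Fin N}
    (h : nextFree occ a = none) (x : Fin N) (hx : a < x) : x ∈ occ := by
  unfold nextFree at h
  split_ifs at h with hne
  by_contra hx'
  exact hne ⟨x, by simp [hx, hx']⟩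

lemma mem_of_prevFree_eq_some {N : ℕ} {occ : Finset (Fin N)} {a s : Fin N}
    (h : prevFree occ a = some s) :
    s < a ∧ s ∉ occ ∧ ∀ x, s < x → x < a → x ∈ occ := by
  unfold prevFree at h
  split_ifs at h with hne
  have hs := Option.some_injective _ h
  have hmem := Finset.max'_mem _ hne
  rw [hs] at hmem
  simp only [Finset.mem_filter, Finset.mem_univ, true_and] at hmem
  refine ⟨hmem.1, hmem.2, fun x hsx hxa => ?_⟩
  by_contra hx
  have := Finset.le_max' (Finset.univ.filter fun s => s < a ∧ s ∉ occ) x (by simp [hxa, hx])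
  rw [hs] at this
  exact absurd hsx (not_lt.2 this)

lemma mem_of_prevFree_eq_none {N : ℕ} {occ : Finset (Fin N)} {a : Fin N}
    (h : prevFree occ a = none) (x : Fin N) (hx : x < a) : x ∈ occ := by
  unfold prevFree at h
  split_ifs at h with hne
  by_contra hx'
  exact hne ⟨x, by simp [hx, hx']⟩

lemma add_side_true {M : ℕ} (a u : ℕ) :
    (a : ZMod M) + (u : ZMod M) * side true = ((a + u : ℕ) : ZMod M) := by simp [side]

lemma add_side_false {M : ℕ} {a u : ℕ} (h : u ≤ a) :
    (a : ZMod M) + (u : ZMod M) * side false = ((a - u : ℕ) : ZMod M) := by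
  simp [side, Nat.cast_sub h, sub_eq_add_neg]

lemma notMem_of_parkSpot_eq_some {N : ℕ} {occ : Finset (Fin N)} {a s : Fin N} {heads : Bool}
    (h : parkSpot occ a heads = some s) : s ∉ occ := by
  unfold parkSpot at h
  split_ifs at h with h1 h2
  · exact (mem_of_nextFree_eq_some h).2.1
  · exact (mem_of_prevFree_eq_some h).2.1
  · exact Option.some_injective _ h ▸ h1

lemma parkSpot_ne_some_iff {N : ℕ} (occ : Finset (Fin N)) (a : Fin N) (heads : Bool) :
    parkSpot occ a heads ≠ some a ↔ a ∈ occ := by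
  constructor
  · intro h
    by_contra ha
    exact h (by simp [parkSpot, ha])
  · intro ha h
    exact notMem_of_parkSpot_eq_some h ha

/-- A car that parks on the street stops before it reaches the added spots, so both searches visit
the same spots. -/
lemma circSpot_of_parkSpot_eq_some {N M : ℕ} (h : N ≤ M) {occ : Finset (Fin N)} {a s : Fin N}
    {heads : Bool} (hs : parkSpot occ a heads = some s) :
    circSpot (occ.map (toCirc h)) (toCirc h a) heads = toCirc h s := by
  have hfree := notMem_of_parkSpot_eq_some hs
  unfold parkSpot at hs
  split_ifs at hs with h1 h2
  · have ha : a ∈ occ := by simpa using h1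
    obtain ⟨hlt, -, hbetween⟩ := mem_of_nextFree_eq_some hs
    rw [Fin.lt_def] at hlt
    have key : (a : ZMod M) + ((s - a : ℕ) : ZMod M) * side true = toCirc h s := by
      rw [add_side_true, toCirc_apply]; congr 1; omega
    rw [h2, ← key]
    refine circSpot_eq _ ?_ fun u hu => ?_
    · rw [toCirc_apply, key, toCirc_apply, natCast_mem_map_toCirc h _ s.isLt]; exact hfree
    · rw [toCirc_apply, add_side_true, natCast_mem_map_toCirc h _ (by omega)]
      rcases Nat.eq_zero_or_pos u with rfl | hpos
      · simpa using ha
      · exact hbetween _ (Fin.lt_def.2 (by simp; omega)) (Fin.lt_def.2 (by simp; omega))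
  · have ha : a ∈ occ := by simpa using h1
    obtain ⟨hlt, -, hbetween⟩ := mem_of_prevFree_eq_some hs
    rw [Fin.lt_def] at hlt
    have key : (a : ZMod M) + ((a - s : ℕ) : ZMod M) * side false = toCirc h s := by
      rw [add_side_false (by omega), toCirc_apply]; congr 1; omega
    rw [Bool.eq_false_iff.2 h2, ← key]
    refine circSpot_eq _ ?_ fun u hu => ?_
    · rw [toCirc_apply, key, toCirc_apply, natCast_mem_map_toCirc h _ s.isLt]; exact hfree
    · rw [toCirc_apply, add_side_false (by omega), natCast_mem_map_toCirc h _ (by omega)]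
      rcases Nat.eq_zero_or_pos u with rfl | hpos
      · simpa using ha
      · exact hbetween _ (Fin.lt_def.2 (by simp; omega)) (Fin.lt_def.2 (by simp; omega))
  · obtain rfl := Option.some_injective _ hs
    have := circSpot_eq (occ := occ.map (toCirc h)) (a := toCirc h a) (heads := heads) 0
      (by simpa using hfree) (by simp)
    simpa using this

/-- A car that leaves the street enters the added stretch, at `N` going forward or at `M - 1` going
backward, and finds it free. -/
lemma circSpot_of_parkSpot_eq_none {N M : ℕ} (h : N < M) {occ : Finset (Fin N)} {a : Fin N}
    {heads : Bool} (hs : parkSpot occ a heads = none) :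
    circSpot (occ.map (toCirc h.le)) (toCirc h.le a) heads ∉ Set.range (toCirc h.le) := by
  unfold parkSpot at hs
  split_ifs at hs with h1 h2
  · have ha : a ∈ occ := by simpa using h1
    have key : (a : ZMod M) + ((N - a : ℕ) : ZMod M) * side true = (N : ZMod M) := by
      rw [add_side_true]; congr 1; omega
    have hN := natCast_notMem_range_toCirc h.le le_rfl h
    rw [h2, circSpot_eq (N - a : ℕ)]
    · rw [toCirc_apply, key]; exact hN
    · rw [toCirc_apply, key]
      exact fun hmem => hN (map_toCirc_subset_range h.le _ hmem)
    · intro u hu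
      rw [toCirc_apply, add_side_true, natCast_mem_map_toCirc h.le _ (by omega)]
      rcases Nat.eq_zero_or_pos u with rfl | hpos
      · simpa using ha
      · exact mem_of_nextFree_eq_none hs _ (Fin.lt_def.2 (by simp; omega))
  · have ha : a ∈ occ := by simpa using h1
    have key : (a : ZMod M) + ((a + 1 : ℕ) : ZMod M) * side false = ((M - 1 : ℕ) : ZMod M) := by
      rw [Nat.cast_sub (show 1 ≤ M by omega)]; simp [side]
    have hN := natCast_notMem_range_toCirc h.le (n := M - 1) (by omega) (by omega)
    rw [Bool.eq_false_iff.2 h2, circSpot_eq (a + 1 : ℕ)]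
    · rw [toCirc_apply, key]; exact hN
    · rw [toCirc_apply, key]
      exact fun hmem => hN (map_toCirc_subset_range h.le _ hmem)
    · intro u hu
      rw [toCirc_apply, add_side_false (by omega), natCast_mem_map_toCirc h.le _ (by omega)]
      rcases Nat.eq_zero_or_pos u with rfl | hpos
      · simpa using ha
      · exact mem_of_prevFree_eq_none hs _ (Fin.lt_def.2 (by simp; omega))

/-- The coins of a run, continued by heads. -/
def coins {m N : ℕ} (ω : Run m N) (i : ℕ) : Bool := if h : i < m then ω.2 ⟨i, h⟩ else true

/-- The preferences of a run, as spots of the circular street. -/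
def circPref {m N M : ℕ} (h : N ≤ M) (ω : Run m N) : Fin m → ZMod M := fun i => toCirc h (ω.1 i)

lemma occupied_succ {m N : ℕ} (ω : Run m N) {i : ℕ} (hi : i < m) :
    occupied ω (i + 1) =
      occupied ω i ∪ (parkSpot (occupied ω i) (ω.1 ⟨i, hi⟩) (ω.2 ⟨i, hi⟩)).toFinset := by
  simp [occupied, hi]

lemma circOccupied_succ {m N M : ℕ} (h : N ≤ M) (ω : Run m N) {i : ℕ} (hi : i < m) :
    circOccupied (coins ω) (i + 1) (initial (circPref h ω) (i + 1) hi) =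
      insert (circSpot (circOccupied (coins ω) i (initial (circPref h ω) i hi.le))
        (toCirc h (ω.1 ⟨i, hi⟩)) (ω.2 ⟨i, hi⟩))
      (circOccupied (coins ω) i (initial (circPref h ω) i hi.le)) := by
  rw [circOccupied, init_initial]
  simp only [coins, hi, dite_true]
  rfl

lemma circOccupied_succ_eq {m N M : ℕ} (h : N ≤ M) (ω : Run m N) {i : ℕ} (hi : i < m)
    (ih : circOccupied (coins ω) i (initial (circPref h ω) i hi.le) =
      (occupied ω i).map (toCirc h))
    (hne : parkSpot (occupied ω i) (ω.1 ⟨i, hi⟩) (ω.2 ⟨i, hi⟩) ≠ none) :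
    circOccupied (coins ω) (i + 1) (initial (circPref h ω) (i + 1) hi) =
      (occupied ω (i + 1)).map (toCirc h) := by
  obtain ⟨s, hs⟩ := Option.ne_none_iff_exists'.1 hne
  rw [circOccupied_succ, ih, circSpot_of_parkSpot_eq_some h hs, occupied_succ _ hi, hs]
  ext x
  simp [eq_comm]

lemma card_occupied_le {m N : ℕ} (ω : Run m N) {i j : ℕ} (hij : i ≤ j) :
    (occupied ω j).card ≤ (occupied ω i).card + (j - i) := by
  induction j, hij using Nat.le_induction with
  | base => simp
  | succ j hij ih =>
    rw [occupied]
    split_ifs with h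
    · refine (Finset.card_union_le _ _).trans ?_
      have : (parkSpot (occupied ω j) (ω.1 ⟨j, h⟩) (ω.2 ⟨j, h⟩)).toFinset.card ≤ 1 := by
        cases parkSpot (occupied ω j) (ω.1 ⟨j, h⟩) (ω.2 ⟨j, h⟩) <;> simp
      omega
    · omega

/-- Each car takes at most one spot, so the loss of one car cannot be made up for. -/
lemma parkSpot_ne_none_of_card {m N : ℕ} (ω : Run m N) (h : (occupied ω m).card = m) {i : ℕ}
    (hi : i < m) : parkSpot (occupied ω i) (ω.1 ⟨i, hi⟩) (ω.2 ⟨i, hi⟩) ≠ none := by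
  intro hnone
  have h1 := card_occupied_le ω (Nat.zero_le i)
  have h2 : occupied ω (i + 1) = occupied ω i := by simp [occupied_succ ω hi, hnone]
  have h3 := card_occupied_le ω (Nat.succ_le_of_lt hi)
  simp only [Nat.succ_eq_add_one, h2] at h3
  simp only [occupied, Finset.card_empty] at h1
  omega

lemma circOccupied_eq_of_card {m N M : ℕ} (h : N ≤ M) (ω : Run m N)
    (hcard : (occupied ω m).card = m) (i : ℕ) (hi : i ≤ m) :
    circOccupied (coins ω) i (initial (circPref h ω) i hi) = (occupied ω i).map (toCirc h) := by
  induction i with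
  | zero => rfl
  | succ i ih =>
    exact circOccupied_succ_eq h ω hi (ih (by omega)) (parkSpot_ne_none_of_card ω hcard hi)

/-- The first car to leave the street would take an added spot on the circle, and this spot would
stay taken. -/
lemma circOccupied_eq_of_subset {m N M : ℕ} (h : N < M) (ω : Run m N)
    (hsub : ∀ x ∈ circOccupied (coins ω) m (circPref h.le ω), x ∈ Set.range (toCirc h.le))
    (i : ℕ) (hi : i ≤ m) :
    circOccupied (coins ω) i (initial (circPref h.le ω) i hi) =
      (occupied ω i).map (toCirc h.le) := by
  induction i with
  | zero => rfl
  | succ i ih =>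
    have ih := ih (by omega)
    refine circOccupied_succ_eq h.le ω hi ih fun hnone => ?_
    refine circSpot_of_parkSpot_eq_none h hnone (hsub _ ?_)
    apply circOccupied_initial_subset (coins ω) _ (i + 1) hi
    rw [circOccupied_succ, ih]
    exact Finset.mem_insert_self _ _

/-- A car is unlucky exactly when its preference is taken on arrival; as all cars park, the taken
spots are the same on the street and on the circle. -/
lemma unlucky_eq_hits {m N M : ℕ} (h : N ≤ M) (ω : Run m N)
    (hcard : (occupied ω m).card = m) :
    unlucky ω = hits (circOccupied (coins ω)) (circPref h ω) := by
  unfold unlucky hits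
  congr 1
  ext i
  simp only [Finset.mem_filter, Finset.mem_univ, true_and]
  rw [circOccupied_eq_of_card h ω hcard i i.isLt.le, outcome, parkSpot_ne_some_iff]
  exact (Finset.mem_map' _).symm

lemma repeats_eq_hits {m N M : ℕ} (h : N ≤ M) (ω : Run m N) :
    repeats ω = hits lastEntry (circPref h ω) := by
  unfold repeats hits
  congr 1
  ext ⟨i, hi⟩
  simp only [Finset.mem_filter, Finset.mem_univ, true_and]
  cases i with
  | zero => simp [lastEntry]
  | succ i =>
    simp only [lastEntry, Finset.mem_singleton, circPref, initial]
    constructor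
    · rintro ⟨j, hj, heq⟩
      have hj' : j = Fin.castLE hi.le (Fin.last i) := Fin.ext (by simpa using hj)
      rw [← heq, hj']
    · intro heq
      exact ⟨⟨i, by omega⟩, rfl, ((toCirc h).injective heq).symm⟩

/-! ### The parking event as a condition on the circle -/

lemma mem_range_toCirc_of_sparseEnds {N M r : ℕ} (hN : N + r = M) (hr : 1 ≤ r)
    {O : Finset (ZMod M)} (hO : SparseEnds r O) {x : ZMod M} (hx : x ∈ O) :
    x ∈ Set.range (toCirc (show N ≤ M by omega)) := by
  have : NeZero M := ⟨by omega⟩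
  -- For `t = r` the condition forces the last `r` spots, which are the added ones, to be empty.
  have hlt := hO r hr (by omega)
  by_contra hxr
  have hval : N ≤ x.val := by
    by_contra! hlt'
    exact hxr ⟨⟨x.val, hlt'⟩, by simp [toCirc_apply]⟩
  have hxM := x.val_lt
  have hpos : 0 < ((Finset.range r).filter fun i : ℕ => (-1 - (i : ZMod M)) ∈ O).card := by
    refine Finset.card_pos.2 ⟨M - 1 - x.val, ?_⟩
    simp only [Finset.mem_filter, Finset.mem_range]
    refine ⟨by omega, ?_⟩
    rw [Nat.sub_sub, Nat.cast_sub (by omega)]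
    simpa using hx
  have := Nat.mul_le_mul_left r hpos
  omega

lemma card_final_stretch {N M : ℕ} (h : N ≤ M) (occ : Finset (Fin N)) {t : ℕ} (ht : t ≤ M) :
    ((Finset.range t).filter fun i : ℕ => (-1 - (i : ZMod M)) ∈ occ.map (toCirc h)).card =
      (occ.filter fun s : Fin N => M ≤ (s : ℕ) + t).card := by
  have key (i : ℕ) (hi : i < M) : (-1 - (i : ZMod M)) = ((M - 1 - i : ℕ) : ZMod M) := by
    rw [Nat.sub_sub, Nat.cast_sub (by omega)]; simp; ring
  symm
  refine Finset.card_bij (fun s _ => M - 1 - s) ?_ ?_ ?_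
  · intro s hs
    rw [Finset.mem_filter] at hs
    simp only [Finset.mem_filter, Finset.mem_range]
    have := s.isLt
    refine ⟨by omega, ?_⟩
    rw [key _ (by omega), show M - 1 - (M - 1 - (s : ℕ)) = s by omega,
      natCast_mem_map_toCirc h occ s.isLt]
    exact hs.1
  · intro s hs s' hs' heq
    have := s.isLt; have := s'.isLt
    exact Fin.ext (by omega)
  · intro i hi
    simp only [Finset.mem_filter, Finset.mem_range] at hi
    obtain ⟨s, hs, hse⟩ := Finset.mem_map.1 hi.2
    have hsN := s.isLt
    rw [key _ (by omega), toCirc_apply] at hse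
    have hval := congrArg ZMod.val hse
    rw [ZMod.val_cast_of_lt (by omega), ZMod.val_cast_of_lt (by omega)] at hval
    exact ⟨s, Finset.mem_filter.2 ⟨hs, by omega⟩, by omega⟩

/-- With `i` counted from `0`, the bound is `M - (m - i) * r`. It fails for the car at `i` exactly
when the last `(m - i) * r` spots contain this car and so at least `m - i` cars; lengths of this
form are the critical ones. -/
lemma sparseEnds_map_toCirc_iff {N M r k m : ℕ} (hr : 1 ≤ r) (hN : N + r = M)
    (hM : k + m * r = M) (occ : Finset (Fin N)) (hcard : occ.card = m) :
    SparseEnds r (occ.map (toCirc (show N ≤ M by omega))) ↔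
      ∀ i : Fin m, (occ.orderEmbOfFin hcard i : ℕ) + 1 ≤ bound r k i := by
  have hcount (t : ℕ) (ht : t ≤ M) :
      ((Finset.range t).filter fun i : ℕ => (-1 - (i : ZMod M)) ∈
        occ.map (toCirc (show N ≤ M by omega))).card =
      (Finset.univ.filter fun i : Fin m => M ≤ occ.orderEmbOfFin hcard i + t).card := by
    rw [card_final_stretch _ _ ht]
    conv_lhs => rw [← Finset.map_orderEmbOfFin_univ occ hcard]
    rw [Finset.filter_map, Finset.card_map]
    rfl
  constructor
  · intro h i
    by_contra! hlt
    rw [bound] at hlt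
    have hi := i.isLt
    have hsplit : m * r = i * r + (m - i) * r := by rw [← add_mul]; congr 1; omega
    have hpos : 1 * 1 ≤ (m - i) * r := Nat.mul_le_mul (by omega) hr
    have hs := h ((m - i) * r) hpos (by omega)
    rw [hcount _ (by omega)] at hs
    have hsub : Finset.Ici i ⊆ Finset.univ.filter fun j : Fin m =>
        M ≤ occ.orderEmbOfFin hcard j + (m - i) * r := by
      intro j hj
      have hle : occ.orderEmbOfFin hcard i ≤ occ.orderEmbOfFin hcard j :=
        (occ.orderEmbOfFin hcard).monotone (Finset.mem_Ici.1 hj)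
      rw [Fin.le_def] at hle
      simp only [Finset.mem_filter, Finset.mem_univ, true_and]
      omega
    have hc := Finset.card_le_card hsub
    rw [Fin.card_Ici] at hc
    have := Nat.mul_le_mul_left r hc
    rw [mul_comm r (m - i)] at this
    omega
  · intro h t ht htM
    rw [hcount t htM]
    set q := (Finset.univ.filter fun i : Fin m => M ≤ occ.orderEmbOfFin hcard i + t).card with hq
    rcases Nat.eq_zero_or_pos q with hq0 | hqpos
    · rw [hq0]; omega
    have hqm : q ≤ m := by
      simpa using Finset.card_le_univ
        (Finset.univ.filter fun i : Fin m => M ≤ occ.orderEmbOfFin hcard i + t)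
    -- The `q` cars in the stretch are the `q` rightmost ones, so this index is that of the leftmost
    -- among them; its bound gives `q * r < t`.
    let i : Fin m := ⟨m - q, by omega⟩
    have hi : M ≤ occ.orderEmbOfFin hcard i + t := by
      by_contra! hlt
      have hsub : (Finset.univ.filter fun i : Fin m => M ≤ occ.orderEmbOfFin hcard i + t) ⊆
          Finset.Ioi i := by
        intro j hj
        simp only [Finset.mem_filter, Finset.mem_univ, true_and] at hj
        rw [Finset.mem_Ioi]
        by_contra! hji
        have hle : occ.orderEmbOfFin hcard j ≤ occ.orderEmbOfFin hcard i :=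
          (occ.orderEmbOfFin hcard).monotone hji
        rw [Fin.le_def] at hle
        omega
      have hc := Finset.card_le_card hsub
      rw [Fin.card_Ioi, ← hq] at hc
      have : (i : ℕ) = m - q := rfl
      omega
    have hb := h i
    rw [bound] at hb
    have hsplit : m * r = i * r + q * r := by
      rw [← add_mul]; congr 1; change m = m - q + q; omega
    rw [mul_comm r q]
    omega

/-- The parking event, seen on the circular street. -/
lemma mem_parkingEvent_iff {r k m M : ℕ} (hr : 1 ≤ r) (hN : streetLength r k m + r = M)
    (hM : k + m * r = M) (hmM : m ≤ M) (ω : Run m (streetLength r k m)) :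
    ω ∈ parkingEvent r k m ↔
      SparseEnds r (circOccupied (coins ω) m
        (circPref (show streetLength r k m ≤ M by omega) ω)) := by
  have : NeZero M := ⟨by omega⟩
  constructor
  · rintro ⟨hcard, h⟩
    have := circOccupied_eq_of_card (show streetLength r k m ≤ M by omega) ω hcard m le_rfl
    rw [initial_self] at this
    rw [this]
    exact (sparseEnds_map_toCirc_iff hr hN hM _ hcard).2 h
  · intro h
    have heq := circOccupied_eq_of_subset (show streetLength r k m < M by omega) ω
      (fun x hx => mem_range_toCirc_of_sparseEnds hN hr h hx) m le_rfl
    rw [initial_self] at heq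
    have hcard : (occupied ω m).card = m := by
      rw [← Finset.card_map, ← heq, card_circOccupied _ _ hmM]
    rw [heq] at h
    exact ⟨hcard, (sparseEnds_map_toCirc_iff hr hN hM _ hcard).1 h⟩

/-! ### Conditioning on the parking event -/

open Classical in
lemma card_parkingEvent_fiber {r k m M : ℕ} [NeZero M] (hr : 1 ≤ r) (hk : 0 < k)
    (hN : streetLength r k m + r = M) (hM : k + m * r = M) (hmM : m ≤ M)
    (S : Set (Run m (streetLength r k m))) (P : (ℕ → Bool) → (Fin m → ZMod M) → Prop)
    (hP : ∀ b π c, P b (fun i => π i + c) ↔ P b π)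
    (hS : ∀ ω ∈ parkingEvent r k m, (ω ∈ S ↔
      P (coins ω) (circPref (show streetLength r k m ≤ M by omega) ω)))
    (b : Fin m → Bool) :
    M * {π : Fin m → Fin (streetLength r k m) | (π, b) ∈ parkingEvent r k m ∩ S}.ncard =
      k * (Finset.univ.filter fun π : Fin m → ZMod M =>
        P (fun i => if h : i < m then b ⟨i, h⟩ else true) π).card := by
  have hNM : streetLength r k m ≤ M := by omega
  have hcoins (π : Fin m → Fin (streetLength r k m)) :
      (fun i => if h : i < m then b ⟨i, h⟩ else true) = coins (N := streetLength r k m) (π, b) := rfl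
  have hmem (π : Fin m → Fin (streetLength r k m)) : (π, b) ∈ parkingEvent r k m ∩ S ↔
      SparseEnds r (circOccupied (fun i => if h : i < m then b ⟨i, h⟩ else true) m
        fun i => toCirc hNM (π i)) ∧
      P (fun i => if h : i < m then b ⟨i, h⟩ else true) fun i => toCirc hNM (π i) := by
    rw [hcoins π, Set.mem_inter_iff, and_congr_right (hS (π, b)),
      mem_parkingEvent_iff hr hN hM hmM]
    rfl
  have hncard : {π : Fin m → Fin (streetLength r k m) | (π, b) ∈ parkingEvent r k m ∩ S} =
      ↑(Finset.univ.filter fun π : Fin m → Fin (streetLength r k m) =>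
        (π, b) ∈ parkingEvent r k m ∩ S) := by ext; simp
  rw [hncard, Set.ncard_coe_finset]
  simp only [hmem]
  generalize (fun i => if h : i < m then b ⟨i, h⟩ else true) = b'
  rw [← card_sparseEnds r k m hk hmM hM b' (P b') (hP b')]
  congr 1
  refine Finset.card_bij (fun π _ i => toCirc hNM (π i)) ?_ ?_ ?_
  · intro π hπ
    simpa using hπ
  · intro π _ π' _ h
    funext i
    exact (toCirc hNM).injective (congrFun h i)
  · intro π hπ
    simp only [Finset.mem_filter, Finset.mem_univ, true_and] at hπ
    -- Every preference is taken in the end and sparse ends keep the added spots empty, so all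
    -- preferences lie on the street.
    choose ρ hρ using fun i =>
      mem_range_toCirc_of_sparseEnds hN hr hπ.1 (mem_circOccupied b' π i)
    have hπρ : (fun i => toCirc hNM (ρ i)) = π := funext hρ
    exact ⟨ρ, by simpa [hπρ] using hπ, hπρ⟩

/-- The dependence on `p` disappears here: the probability given the coins is constant, so
integrating over them changes nothing. -/
lemma runLaw_eq_of_card {p : unitInterval} {m N n : ℕ} (S : Set (Run m N))
    (hS : ∀ b : Fin m → Bool, {π : Fin m → Fin N | (π, b) ∈ S}.ncard = n) :
    runLaw p m N S = (n : ENNReal) / (N ^ m : ℕ) := by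
  have hfib (b : Fin m → Bool) : uniformOn (Set.univ : Set (Fin m → Fin N))
      ((fun π => (π, b)) ⁻¹' S) = (n : ENNReal) / (N ^ m : ℕ) := by
    rw [uniformOn_univ, ← hS b, Measure.count_apply (Set.toFinite _).measurableSet,
      ← (Set.toFinite _).cast_ncard_eq]
    simp only [Fintype.card_pi, Fintype.card_fin, Finset.prod_const, Finset.card_univ]
    rfl
  rw [runLaw, Measure.prod_apply_symm (Set.toFinite S).measurableSet]
  simp [hfib]

open Classical in
/-- Conditioning on the parking event amounts to parking on the circular street. -/
lemma parkingLaw_real_eq {p : unitInterval} {r k m M C : ℕ} [NeZero M] (hr : 1 ≤ r) (hk : 0 < k)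
    (hN : streetLength r k m + r = M) (hM : k + m * r = M) (hmM : m ≤ M)
    (S : Set (Run m (streetLength r k m))) (P : (ℕ → Bool) → (Fin m → ZMod M) → Prop)
    (hP : ∀ b π c, P b (fun i => π i + c) ↔ P b π)
    (hS : ∀ ω ∈ parkingEvent r k m, (ω ∈ S ↔
      P (coins ω) (circPref (show streetLength r k m ≤ M by omega) ω)))
    (hC : ∀ b, (Finset.univ.filter fun π : Fin m → ZMod M => P b π).card = C) :
    (parkingLaw p r k m).real S = C / (M : ℝ) ^ m := by
  have hMpos : 0 < M := NeZero.pos M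
  have h1 (b : Fin m → Bool) := (card_parkingEvent_fiber hr hk hN hM hmM S P hP hS b).trans
    (by rw [hC])
  -- The trivial property gives the size of the parking event itself; the factor `k / M` then
  -- cancels in the conditional probability.
  have h2 (b : Fin m → Bool) := (card_parkingEvent_fiber hr hk hN hM hmM Set.univ (fun _ _ => True)
    (by simp) (by simp) b).trans (by rw [Finset.filter_true, Finset.card_univ])
  obtain ⟨n₁, hn₁⟩ : ∃ n, {π : Fin m → Fin (streetLength r k m) |
    (π, fun _ => true) ∈ parkingEvent r k m ∩ S}.ncard = n := ⟨_, rfl⟩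
  obtain ⟨n₂, hn₂⟩ : ∃ n, {π : Fin m → Fin (streetLength r k m) |
    (π, fun _ => true) ∈ parkingEvent r k m ∩ Set.univ}.ncard = n := ⟨_, rfl⟩
  have h1' := runLaw_eq_of_card (p := p) (n := n₁) (parkingEvent r k m ∩ S)
    (fun b => hn₁ ▸ Nat.eq_of_mul_eq_mul_left hMpos ((h1 b).trans (h1 fun _ => true).symm))
  have h2' := runLaw_eq_of_card (p := p) (n := n₂) (parkingEvent r k m ∩ Set.univ)
    (fun b => hn₂ ▸ Nat.eq_of_mul_eq_mul_left hMpos ((h2 b).trans (h2 fun _ => true).symm))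
  rw [Set.inter_univ] at h2'
  have h1 := h1 fun _ => true
  have h2 := h2 fun _ => true
  rw [hn₁] at h1
  rw [hn₂] at h2
  have hcard : Fintype.card (Fin m → ZMod M) = M ^ m := by simp
  rw [hcard] at h2
  rw [parkingLaw, measureReal_def, cond_apply (Set.toFinite _).measurableSet,
    ← ENNReal.div_eq_inv_mul, h1', h2']
  have hstreet : 0 < streetLength r k m := by rw [streetLength]; omega
  have hMR : (M : ℝ) ≠ 0 := by positivity
  have hkR : (k : ℝ) ≠ 0 := by positivity
  have h1R : (M : ℝ) * n₁ = k * C := by exact_mod_cast h1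
  have h2R : (M : ℝ) * n₂ = k * M ^ m := by exact_mod_cast h2
  have hn₂ : (n₂ : ℝ) ≠ 0 := by
    intro h0
    rw [h0, mul_zero] at h2R
    exact mul_ne_zero hkR (pow_ne_zero _ hMR) h2R.symm
  have hs : ((streetLength r k m ^ m : ℕ) : ℝ) ≠ 0 := by positivity
  simp only [ENNReal.toReal_div, ENNReal.toReal_natCast]
  field_simp
  have : (M : ℝ) * k * (n₁ * M ^ m) = M * k * (n₂ * C) := by
    linear_combination (k : ℝ) * (M : ℝ) ^ m * h1R - (k : ℝ) * C * h2R
  have := mul_left_cancel₀ (mul_ne_zero hMR hkR) this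
  linarith

/-! ### Poisson limit of the repeats -/

lemma card_lastEntry {α : Type*} (n : ℕ) (π : Fin n → α) :
    (lastEntry n π).card = if n = 0 then 0 else 1 := by
  cases n <;> simp [lastEntry]

/-- The first car has an empty target and each later one a single spot, so the generating function
is `M * (M - 1 + X) ^ (m - 1)`. -/
lemma card_hits_lastEntry {M : ℕ} [NeZero M] {m : ℕ} (hm : 1 ≤ m) (j : ℕ) :
    ((Finset.univ.filter fun π : Fin m → ZMod M => hits lastEntry π = j).card : ℝ) /
        (M : ℝ) ^ m =
      (m - 1).choose j * (1 / (M : ℝ)) ^ j * (1 - 1 / (M : ℝ)) ^ (m - 1 - j) := by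
  obtain ⟨n, rfl⟩ := Nat.exists_eq_add_of_le' hm
  rw [Nat.add_sub_cancel]
  have h := card_hits_eq (α := ZMod M) lastEntry (fun i => if i = 0 then 0 else 1) (n + 1)
    (fun i _ π => card_lastEntry i π) j
  rw [Finset.prod_range_succ'] at h
  simp only [ZMod.card, Nat.add_eq_zero_iff, one_ne_zero, and_false, ↓reduceIte, Nat.cast_one,
    Finset.prod_const, Finset.card_range, Nat.cast_zero, one_mul, zero_mul, add_zero,
    sub_zero] at h
  have h2 : ((M : Polynomial ℤ) - 1 + Polynomial.X) =
      Polynomial.X + Polynomial.C ((M : ℤ) - 1) := by simp; ring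
  have h3 : (M : Polynomial ℤ) = Polynomial.C (M : ℤ) := by simp
  rw [h2, h3, Polynomial.coeff_mul_C, Polynomial.coeff_X_add_C_pow] at h
  have hR : ((Finset.univ.filter fun π : Fin (n + 1) → ZMod M => hits lastEntry π = j).card : ℝ) =
      ((M : ℝ) - 1) ^ (n - j) * n.choose j * M := by exact_mod_cast h
  have hM : (M : ℝ) ≠ 0 := Nat.cast_ne_zero.2 (NeZero.ne M)
  rw [hR]
  rcases le_or_gt j n with hjn | hjn
  · rw [show 1 - 1 / (M : ℝ) = ((M : ℝ) - 1) / M by field_simp, div_pow, div_pow,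
      show (M : ℝ) ^ (n + 1) = M ^ j * M ^ (n - j) * M by
        rw [← pow_add, ← pow_succ]; congr 1; omega]
    field_simp
    ring
  · simp [Nat.choose_eq_zero_of_lt hjn]

lemma tendsto_repeats_limit {A r : ℝ} (hA : 0 < A) (m : ℕ → ℕ) (hm : Tendsto m atTop atTop)
    (j : ℕ) :
    Tendsto (fun n => ((m n - 1).choose j : ℝ) * (1 / (A * m n + r)) ^ j *
      (1 - 1 / (A * m n + r)) ^ (m n - 1 - j)) atTop
      (𝓝 ((1 / A) ^ j * Real.exp (-(1 / A)) / j.factorial)) := by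
  -- Indexed by the number `n = m - 1` of trials, as the Poisson limit theorem requires.
  set p : ℕ → ℝ := fun n => 1 / (A * (n + 1) + r) with hp
  have hlim : Tendsto (fun n : ℕ => (n : ℝ) * p n) atTop (𝓝 (1 / A)) := by
    have h1 : Tendsto (fun n : ℕ => 1 / (A + (A + r) * (n : ℝ)⁻¹)) atTop
        (𝓝 (1 / (A + (A + r) * 0))) := by
      refine Tendsto.div tendsto_const_nhds (tendsto_const_nhds.add
        (tendsto_const_nhds.mul tendsto_inv_atTop_nhds_zero_nat)) (by simpa using hA.ne')
    rw [mul_zero, add_zero] at h1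
    refine h1.congr' ?_
    filter_upwards [eventually_ge_atTop 1] with n hn
    have hn' : (n : ℝ) ≠ 0 := by positivity
    rw [hp]
    simp only
    rw [show A + (A + r) * (n : ℝ)⁻¹ = (A * (n + 1) + r) / n by field_simp; ring]
    simp [div_eq_mul_inv]
  have h := (tendsto_choose_mul_pow_of_tendsto_mul_atTop j hlim).comp
    ((tendsto_sub_atTop_nat 1).comp hm)
  rw [mul_comm (Real.exp _)] at h
  refine h.congr' ?_
  filter_upwards [hm.eventually_ge_atTop 1] with n hn
  have : ((m n - 1 : ℕ) : ℝ) + 1 = m n := by rw [Nat.cast_sub hn]; simp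
  simp [hp, this]

/-! ### Central limit theorem for the Bernoulli sums -/

/-- Exchanging the factors one at a time reduces the comparison with a Gaussian product to one of
single factors. -/
lemma norm_prod_sub_prod_le {ι : Type*} (s : Finset ι) (a b : ι → ℂ) (ha : ∀ i ∈ s, ‖a i‖ ≤ 1)
    (hb : ∀ i ∈ s, ‖b i‖ ≤ 1) :
    ‖∏ i ∈ s, a i - ∏ i ∈ s, b i‖ ≤ ∑ i ∈ s, ‖a i - b i‖ := by
  classical
  induction s using Finset.induction_on with
  | empty => simp
  | insert x s hx ih =>
    rw [Finset.prod_insert hx, Finset.prod_insert hx, Finset.sum_insert hx]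
    have ih := ih (fun i hi => ha i (Finset.mem_insert_of_mem hi))
      (fun i hi => hb i (Finset.mem_insert_of_mem hi))
    have hb' : ‖∏ i ∈ s, b i‖ ≤ 1 := by
      rw [norm_prod]
      exact Finset.prod_le_one (fun _ _ => norm_nonneg _)
        fun i hi => hb i (Finset.mem_insert_of_mem hi)
    calc ‖a x * ∏ i ∈ s, a i - b x * ∏ i ∈ s, b i‖
        = ‖(a x - b x) * ∏ i ∈ s, b i + a x * (∏ i ∈ s, a i - ∏ i ∈ s, b i)‖ := by
          congr 1; ring
      _ ≤ ‖a x - b x‖ * 1 + 1 * ‖∏ i ∈ s, a i - ∏ i ∈ s, b i‖ := by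
          refine (norm_add_le _ _).trans ?_
          rw [norm_mul, norm_mul]
          gcongr
          exact ha x (Finset.mem_insert_self _ _)
      _ ≤ _ := by linarith

lemma norm_exp_I_sub_le {x : ℝ} (hx : |x| ≤ 1) :
    ‖Complex.exp (x * Complex.I) - (1 + x * Complex.I - x ^ 2 / 2)‖ ≤ |x| ^ 3 := by
  have hn : ‖(x : ℂ) * Complex.I‖ = |x| := by simp
  have h := Complex.exp_bound (x := x * Complex.I) (by rwa [hn]) (n := 3) (by norm_num)
  rw [hn] at h
  have hs : ∑ i ∈ Finset.range 3, ((x : ℂ) * Complex.I) ^ i / (i.factorial : ℂ) =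
      1 + x * Complex.I - x ^ 2 / 2 := by
    simp only [Finset.sum_range_succ, Finset.sum_range_zero, mul_pow, Complex.I_sq]
    norm_num [Nat.factorial]
    ring
  rw [hs] at h
  refine h.trans ?_
  have : 0 ≤ |x| ^ 3 := by positivity
  norm_num [Nat.factorial]
  linarith

/-- The characteristic function of a centred Bernoulli variable. -/
noncomputable def centredBernoulli (q s : ℝ) : ℂ :=
  Complex.exp (-(s * q) * Complex.I) * (1 - q + q * Complex.exp (s * Complex.I))

lemma centredBernoulli_eq (q s : ℝ) : centredBernoulli q s =
    (1 - q : ℝ) * Complex.exp ((-(s * q) : ℝ) * Complex.I) +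
      (q : ℝ) * Complex.exp ((s * (1 - q) : ℝ) * Complex.I) := by
  rw [centredBernoulli, mul_add, mul_left_comm _ (q : ℂ), ← Complex.exp_add]
  push_cast
  ring_nf

lemma norm_centredBernoulli_le {q s : ℝ} (h0 : 0 ≤ q) (h1 : q ≤ 1) :
    ‖centredBernoulli q s‖ ≤ 1 := by
  rw [centredBernoulli_eq]
  refine (norm_add_le _ _).trans ?_
  rw [norm_mul, norm_mul, Complex.norm_exp_ofReal_mul_I, Complex.norm_exp_ofReal_mul_I,
    Complex.norm_real, Complex.norm_real, Real.norm_of_nonneg h0,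
    Real.norm_of_nonneg (sub_nonneg.2 h1)]
  linarith

/-- Centring cancels the first-order terms, and the second-order expansion of both sides is `1 - v`.
The remainders are cubic, the one of the real exponential because `v ^ 2 ≤ |s| ^ 4 ≤ |s| ^ 3`. -/
lemma norm_centredBernoulli_sub_le {q s : ℝ} (h0 : 0 ≤ q) (h1 : q ≤ 1) (hs : |s| ≤ 1) :
    ‖centredBernoulli q s - (Real.exp (-(q * (1 - q) * s ^ 2 / 2)) : ℝ)‖ ≤ 3 * |s| ^ 3 := by
  set v := q * (1 - q) * s ^ 2 / 2 with hv
  have hq0 : 0 ≤ 1 - q := sub_nonneg.2 h1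
  have hx : |-(s * q)| ≤ |s| := by
    rw [abs_neg, abs_mul, abs_of_nonneg h0]
    exact mul_le_of_le_one_right (abs_nonneg s) h1
  have hy : |s * (1 - q)| ≤ |s| := by
    rw [abs_mul, abs_of_nonneg hq0]
    exact mul_le_of_le_one_right (abs_nonneg s) (by linarith)
  have hX := (norm_exp_I_sub_le (hx.trans hs)).trans (pow_le_pow_left₀ (abs_nonneg _) hx 3)
  have hY := (norm_exp_I_sub_le (hy.trans hs)).trans (pow_le_pow_left₀ (abs_nonneg _) hy 3)
  have hs2 : s ^ 2 = |s| ^ 2 := (sq_abs s).symm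
  have hv0 : 0 ≤ v := by positivity
  have hqq : q * (1 - q) ≤ 1 := by nlinarith
  have hvs : v ≤ |s| ^ 2 := by
    rw [hv, hs2]
    nlinarith [mul_le_mul_of_nonneg_right hqq (sq_nonneg |s|), sq_nonneg |s|]
  have hs1 : |s| ^ 2 ≤ 1 := pow_le_one₀ (abs_nonneg s) hs
  have hE : ‖((1 - v : ℝ) : ℂ) - (Real.exp (-v) : ℝ)‖ ≤ |s| ^ 3 := by
    rw [← Complex.ofReal_sub, Complex.norm_real, Real.norm_eq_abs, abs_sub_comm]
    have h := Real.abs_exp_sub_one_sub_id_le (x := -v) (by rw [abs_neg, abs_of_nonneg hv0]; linarith)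
    rw [show Real.exp (-v) - (1 - v) = Real.exp (-v) - 1 - -v by ring]
    refine h.trans ?_
    calc (-v) ^ 2 = v ^ 2 := by ring
      _ ≤ (|s| ^ 2) ^ 2 := by gcongr
      _ = |s| ^ 3 * |s| := by ring
      _ ≤ |s| ^ 3 * 1 := by gcongr
      _ = _ := by ring
  have hsplit : centredBernoulli q s - (Real.exp (-v) : ℝ) =
      (1 - q : ℝ) * (Complex.exp ((-(s * q) : ℝ) * Complex.I) -
          (1 + (-(s * q) : ℝ) * Complex.I - (-(s * q) : ℝ) ^ 2 / 2)) +
      (q : ℝ) * (Complex.exp ((s * (1 - q) : ℝ) * Complex.I) -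
          (1 + (s * (1 - q) : ℝ) * Complex.I - (s * (1 - q) : ℝ) ^ 2 / 2)) +
      (((1 - v : ℝ) : ℂ) - (Real.exp (-v) : ℝ)) := by
    rw [centredBernoulli_eq, hv]
    push_cast
    ring
  rw [hsplit]
  refine (norm_add₃_le).trans ?_
  rw [norm_mul, norm_mul, Complex.norm_real, Complex.norm_real, Real.norm_of_nonneg h0,
    Real.norm_of_nonneg hq0]
  have hX' := mul_le_mul_of_nonneg_left hX hq0
  have hY' := mul_le_mul_of_nonneg_left hY h0
  have hT : 0 ≤ |s| ^ 3 := by positivity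
  linarith

lemma sum_range_cast (m : ℕ) : ∑ i ∈ Finset.range m, (i : ℝ) = m * (m - 1) / 2 := by
  induction m with
  | zero => simp
  | succ m ih => rw [Finset.sum_range_succ, ih]; push_cast; ring

lemma sum_range_cast_sq (m : ℕ) :
    ∑ i ∈ Finset.range m, (i : ℝ) ^ 2 = m * (m - 1) * (2 * m - 1) / 6 := by
  induction m with
  | zero => simp
  | succ m ih => rw [Finset.sum_range_succ, ih]; push_cast; ring

section Asymptotics

variable {A r : ℝ} {m : ℕ → ℕ}

lemma tendsto_inv_cast (hm : Tendsto m atTop atTop) :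
    Tendsto (fun n => (m n : ℝ)⁻¹) atTop (𝓝 0) :=
  tendsto_inv_atTop_nhds_zero_nat.comp hm

/-- The mean is a Riemann sum for the integral of `(x / A) * (1 - x / A)` over `[0, 1]`, which is `1
/ (2 * A) - 1 / (3 * A ^ 2)`; closed forms of the power sums make it explicit. -/
lemma tendsto_mean_variance (hA : 1 ≤ A) (hr : 0 ≤ r) (hm : Tendsto m atTop atTop) :
    Tendsto (fun n => (m n : ℝ)⁻¹ * ∑ i ∈ Finset.range (m n),
      (i / (A * m n + r) * (1 - i / (A * m n + r)) : ℝ)) atTop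
      (𝓝 ((3 * A - 2) / (6 * A ^ 2))) := by
  have hA0 : A ≠ 0 := by positivity
  have hy := tendsto_inv_cast hm
  have hden : Tendsto (fun n => A + r * (m n : ℝ)⁻¹) atTop (𝓝 (A + r * 0)) :=
    tendsto_const_nhds.add (hy.const_mul r)
  have h1 : Tendsto (fun n => (1 - (m n : ℝ)⁻¹) / (2 * (A + r * (m n : ℝ)⁻¹)) -
      (1 - (m n : ℝ)⁻¹) * (2 - (m n : ℝ)⁻¹) / (6 * (A + r * (m n : ℝ)⁻¹) ^ 2)) atTop
      (𝓝 ((1 - 0) / (2 * (A + r * 0)) - (1 - 0) * (2 - 0) / (6 * (A + r * 0) ^ 2))) := by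
    refine Tendsto.sub (Tendsto.div (tendsto_const_nhds.sub hy) (hden.const_mul 2) ?_)
      (Tendsto.div ((tendsto_const_nhds.sub hy).mul (tendsto_const_nhds.sub hy))
        ((hden.pow 2).const_mul 6) ?_) <;> simp [hA0]
  convert h1.congr' ?_ using 2
  · rw [mul_zero, add_zero]; field_simp; ring
  filter_upwards [hm.eventually_ge_atTop 1] with n hn
  have hmn : (0 : ℝ) < m n := by exact_mod_cast hn
  have hD : A * m n + r ≠ 0 := by positivity
  have hD' : A + r * (m n : ℝ)⁻¹ = (A * m n + r) / m n := by field_simp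
  have hsum : ∑ i ∈ Finset.range (m n), (i / (A * m n + r) * (1 - i / (A * m n + r)) : ℝ) =
      (∑ i ∈ Finset.range (m n), (i : ℝ)) / (A * m n + r) -
      (∑ i ∈ Finset.range (m n), (i : ℝ) ^ 2) / (A * m n + r) ^ 2 := by
    rw [Finset.sum_div, Finset.sum_div, ← Finset.sum_sub_distrib]
    refine Finset.sum_congr rfl fun i _ => ?_
    field_simp
  rw [hsum, sum_range_cast, sum_range_cast_sq, hD']
  field_simp

/-- The bias of the mean is bounded. -/
lemma tendsto_mean_bias (hA : 1 ≤ A) (hr : 0 ≤ r) (hm : Tendsto m atTop atTop) :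
    Tendsto (fun n => (∑ i ∈ Finset.range (m n), (i / (A * m n + r) : ℝ)) -
      1 / (2 * A) * m n) atTop (𝓝 (-(A + r) / (2 * A * A))) := by
  have hA0 : A ≠ 0 := by positivity
  have h1 : Tendsto (fun n => -(A + r) / (2 * A * (A + r * (m n : ℝ)⁻¹))) atTop
      (𝓝 (-(A + r) / (2 * A * (A + r * 0)))) := by
    refine Tendsto.div tendsto_const_nhds ((tendsto_const_nhds.add
      ((tendsto_inv_cast hm).const_mul r)).const_mul _) ?_
    simp [hA0]
  convert h1.congr' ?_ using 2
  · rw [mul_zero, add_zero]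
  filter_upwards [hm.eventually_ge_atTop 1] with n hn
  have hmn : (0 : ℝ) < m n := by exact_mod_cast hn
  have hD : A * m n + r ≠ 0 := by positivity
  have hD' : A + r * (m n : ℝ)⁻¹ = (A * m n + r) / m n := by field_simp
  rw [← Finset.sum_div, sum_range_cast, hD']
  field_simp
  ring

/-- Characteristic functions of standardised sums of independent Bernoulli variables with
parameters `i / (A m + r)`, `i < m`. -/
lemma tendsto_charFun_bernoulli_sum (hA : 1 ≤ A) (hr : 0 ≤ r) (hm : Tendsto m atTop atTop)
    (t : ℝ) (s : ℕ → ℝ)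
    (hs : ∀ n, s n = t / Real.sqrt ((3 * A - 2) / (6 * A ^ 2) * m n)) :
    Tendsto (fun n => Complex.exp (-(s n * (1 / (2 * A) * m n) : ℝ) * Complex.I) *
      ∏ i ∈ Finset.range (m n), ((1 - (i / (A * m n + r) : ℝ) : ℂ) +
        (i / (A * m n + r) : ℝ) * Complex.exp (s n * Complex.I))) atTop
      (𝓝 (Complex.exp (-t ^ 2 / 2))) := by
  set v := (3 * A - 2) / (6 * A ^ 2) with hv
  have hv0 : 0 < v := div_pos (by linarith) (by positivity)
  set q : ℕ → ℕ → ℝ := fun n i => i / (A * m n + r) with hq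
  have hq01 (n : ℕ) (i : ℕ) (hi : i ∈ Finset.range (m n)) : 0 ≤ q n i ∧ q n i ≤ 1 := by
    rw [Finset.mem_range] at hi
    have hi' : (i : ℝ) < m n := by exact_mod_cast hi
    have hmn : (0 : ℝ) < m n := lt_of_le_of_lt (Nat.cast_nonneg i) hi'
    refine ⟨by positivity, div_le_one_of_le₀ ?_ (by positivity)⟩
    nlinarith
  have hs0 : Tendsto s atTop (𝓝 0) := by
    have h := (tendsto_inv_cast hm).sqrt.const_mul (t / Real.sqrt v)
    rw [Real.sqrt_zero, mul_zero] at h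
    refine h.congr fun n => ?_
    rw [hs, Real.sqrt_mul hv0.le, Real.sqrt_inv, div_mul_eq_div_div, div_eq_mul_inv (t / _)]
  have hs2 : ∀ᶠ n in atTop, s n ^ 2 = t ^ 2 / v * (m n : ℝ)⁻¹ := by
    filter_upwards [hm.eventually_ge_atTop 1] with n hn
    have hmn : (0 : ℝ) < m n := by exact_mod_cast hn
    rw [hs, div_pow, Real.sq_sqrt (by positivity)]
    field_simp
  have habs : Tendsto (fun n => |s n|) atTop (𝓝 0) := by simpa using hs0.abs
  -- The total error of `m` factors is of order `m * |s| ^ 3`, a constant times `|s|`, since `m * s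
  -- ^ 2` is constant.
  have hcube : Tendsto (fun n => (m n : ℝ) * (3 * |s n| ^ 3)) atTop (𝓝 0) := by
    have h := habs.const_mul (3 * (t ^ 2 / v))
    rw [mul_zero] at h
    refine h.congr' ?_
    filter_upwards [hs2, hm.eventually_ge_atTop 1] with n hn hn1
    have hmn : (m n : ℝ) ≠ 0 := by positivity
    rw [show |s n| ^ 3 = |s n| ^ 2 * |s n| by ring, sq_abs, hn]
    field_simp
  have hgauss : Tendsto (fun n => ∏ i ∈ Finset.range (m n),
      ((Real.exp (-(q n i * (1 - q n i) * s n ^ 2 / 2)) : ℝ) : ℂ)) atTop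
      (𝓝 (Complex.exp (-t ^ 2 / 2))) := by
    have h := (tendsto_mean_variance hA hr hm).const_mul (-(t ^ 2 / v) / 2)
    have h' := (Complex.continuous_exp.tendsto _).comp
      ((Complex.continuous_ofReal.tendsto _).comp h)
    have hlim : (((-(t ^ 2 / v) / 2 * ((3 * A - 2) / (6 * A ^ 2)) : ℝ)) : ℂ) = -t ^ 2 / 2 := by
      rw [← hv, show -(t ^ 2 / v) / 2 * v = -t ^ 2 / 2 by field_simp]
      push_cast; ring
    rw [hlim] at h'
    refine h'.congr' ?_
    filter_upwards [hs2] with n hn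
    rw [← Complex.ofReal_prod, ← Real.exp_sum, Complex.ofReal_exp]
    simp only [Function.comp]
    congr 2
    rw [hn, Finset.mul_sum, Finset.mul_sum]
    refine Finset.sum_congr rfl fun i _ => ?_
    simp only [hq]
    ring
  have hdiff : Tendsto (fun n => ∏ i ∈ Finset.range (m n), centredBernoulli (q n i) (s n) -
      ∏ i ∈ Finset.range (m n), ((Real.exp (-(q n i * (1 - q n i) * s n ^ 2 / 2)) : ℝ) : ℂ))
      atTop (𝓝 0) := by
    refine squeeze_zero_norm' ?_ hcube
    filter_upwards [habs.eventually_le_const zero_lt_one] with n hn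
    refine (norm_prod_sub_prod_le _ _ _ (fun i hi =>
      norm_centredBernoulli_le (hq01 n i hi).1 (hq01 n i hi).2) fun i hi => ?_).trans ?_
    · rw [Complex.norm_real, Real.norm_of_nonneg (Real.exp_pos _).le, Real.exp_le_one_iff,
        neg_nonpos]
      have := (hq01 n i hi).1
      have := sub_nonneg.2 (hq01 n i hi).2
      positivity
    · refine (Finset.sum_le_card_nsmul _ _ (3 * |s n| ^ 3) fun i hi =>
        norm_centredBernoulli_sub_le (hq01 n i hi).1 (hq01 n i hi).2 hn).trans ?_
      simp
  -- Centring at `m / (2 * A)` instead of the exact mean shifts the phase by `s` times a bounded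
  -- quantity.
  have hbias : Tendsto (fun n => Complex.exp ((s n * ((∑ i ∈ Finset.range (m n), q n i) -
      1 / (2 * A) * m n) : ℝ) * Complex.I)) atTop (𝓝 1) := by
    have h := hs0.mul (tendsto_mean_bias hA hr hm)
    rw [zero_mul] at h
    have h' := (Complex.continuous_exp.tendsto _).comp
      (((Complex.continuous_ofReal.tendsto _).comp h).mul_const Complex.I)
    simpa [hq, Function.comp_def] using h'
  have hfinal := hbias.mul (hdiff.add hgauss)
  rw [zero_add, one_mul] at hfinal
  refine hfinal.congr fun n => ?_
  rw [sub_add_cancel]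
  simp only [centredBernoulli]
  rw [Finset.prod_mul_distrib, ← Complex.exp_sum, ← mul_assoc, ← Complex.exp_add]
  congr 2
  rw [← Finset.sum_mul, Finset.sum_neg_distrib, ← Finset.mul_sum]
  push_cast
  ring

end Asymptotics

/-! ### From characteristic functions to distribution functions -/

open Classical in
/-- Lévy's continuity theorem for finite uniform probability spaces. -/
lemma tendsto_card_le_cdf {Ω : ℕ → Type} [∀ n, Fintype (Ω n)] [∀ n, Nonempty (Ω n)]
    (X : ∀ n, Ω n → ℝ)
    (h : ∀ t : ℝ, Tendsto (fun n => (∑ ω, Complex.exp (t * X n ω * Complex.I)) /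
      (Fintype.card (Ω n) : ℂ)) atTop (𝓝 (Complex.exp (-t ^ 2 / 2)))) (x : ℝ) :
    Tendsto (fun n => ((Finset.univ.filter fun ω => X n ω ≤ x).card : ℝ) / Fintype.card (Ω n))
      atTop (𝓝 (cdf (gaussianReal 0 1) x)) := by
  let (n : ℕ) : MeasurableSpace (Ω n) := ⊤
  have hX (n : ℕ) : Measurable (X n) := measurable_from_top
  have hU (n : ℕ) : IsProbabilityMeasure (uniformOn (Set.univ : Set (Ω n))) :=
    isProbabilityMeasure_uniformOn Set.finite_univ Set.univ_nonempty
  have hU' (n : ℕ) : uniformOn (Set.univ : Set (Ω n)) =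
      (Fintype.card (Ω n) : ENNReal)⁻¹ • Measure.count := by
    ext s hs
    rw [uniformOn_univ, Measure.smul_apply, smul_eq_mul, ENNReal.div_eq_inv_mul]
  let μ (n : ℕ) : ProbabilityMeasure ℝ :=
    ⟨(uniformOn (Set.univ : Set (Ω n))).map (X n),
      Measure.isProbabilityMeasure_map (hX n).aemeasurable⟩
  let μ₀ : ProbabilityMeasure ℝ := ⟨gaussianReal 0 1, inferInstance⟩
  have hlim : Tendsto μ atTop (𝓝 μ₀) := by
    refine ProbabilityMeasure.tendsto_iff_tendsto_charFun.2 fun t => ?_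
    have h0 : charFun (μ₀ : Measure ℝ) t = Complex.exp (-t ^ 2 / 2) := by
      change charFun (gaussianReal 0 1) t = _
      rw [charFun_gaussianReal]
      congr 1
      simp
      ring
    rw [h0]
    refine (h t).congr fun n => ?_
    change _ = charFun ((uniformOn (Set.univ : Set (Ω n))).map (X n)) t
    rw [charFun_apply_real, integral_map (hX n).aemeasurable (by fun_prop), hU',
      integral_smul_measure, integral_count]
    simp [div_eq_inv_mul]
  -- The frontier of the half-line is one point, which is null for the Gaussian law.
  have hset := ProbabilityMeasure.tendsto_measure_of_null_frontier_of_tendsto' hlim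
    (E := Set.Iic x) (by
      rw [frontier_Iic]
      change gaussianReal 0 1 {x} = 0
      have := nullSingletonClass_gaussianReal (μ := 0) (v := 1) one_ne_zero
      simp)
  have hreal := (ENNReal.tendsto_toReal (measure_ne_top (gaussianReal 0 1) (Set.Iic x))).comp hset
  rw [cdf_eq_real]
  refine hreal.congr fun n => ?_
  simp only [Function.comp]
  change ((uniformOn (Set.univ : Set (Ω n))).map (X n) (Set.Iic x)).toReal = _
  rw [Measure.map_apply (hX n) measurableSet_Iic, uniformOn_univ,
    show X n ⁻¹' Set.Iic x = ↑(Finset.univ.filter fun ω => X n ω ≤ x) by ext; simp,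
    Measure.count_apply_finset]
  simp

/-! ### The law of the unlucky cars -/

/-- The generating function of the hits at `exp (s * I)` factorises, since the target at time `i`
always has `i` elements. -/
lemma sum_exp_hits_circOccupied {M : ℕ} [NeZero M] (m : ℕ) (hm : m ≤ M) (b : ℕ → Bool) (a s : ℝ) :
    (∑ π : Fin m → ZMod M, Complex.exp (s * (hits (circOccupied b) π - a) * Complex.I)) /
        (Fintype.card (Fin m → ZMod M) : ℂ) =
      Complex.exp (-(s * a : ℝ) * Complex.I) * ∏ i ∈ Finset.range m,
        ((1 - (i / M : ℝ) : ℂ) + (i / M : ℝ) * Complex.exp (s * Complex.I)) := by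
  have h := sum_pow_hits (α := ZMod M) (circOccupied b) id m
    (fun i hi π => card_circOccupied b i (by omega) π) (Complex.exp (s * Complex.I))
  have hM : (M : ℂ) ≠ 0 := Nat.cast_ne_zero.2 (NeZero.ne M)
  have hterm (π : Fin m → ZMod M) :
      Complex.exp (s * (hits (circOccupied b) π - a) * Complex.I) =
      Complex.exp (-(s * a : ℝ) * Complex.I) *
        Complex.exp (s * Complex.I) ^ hits (circOccupied b) π := by
    rw [← Complex.exp_nat_mul, ← Complex.exp_add]
    congr 1
    push_cast
    ring
  simp_rw [hterm]
  rw [← Finset.mul_sum, h, mul_div_assoc]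
  congr 1
  have hcard : (Fintype.card (Fin m → ZMod M) : ℂ) = ∏ _i ∈ Finset.range m, (M : ℂ) := by simp
  rw [hcard, ← Finset.prod_div_distrib]
  refine Finset.prod_congr rfl fun i _ => ?_
  simp only [ZMod.card, id]
  push_cast
  field_simp

open Classical in
/-- On the circular street the law of the number of unlucky cars does not depend on the coins. -/
lemma card_hits_circOccupied_mem {M : ℕ} [NeZero M] (m : ℕ) (hm : m ≤ M) (b b' : ℕ → Bool)
    (B : Set ℕ) :
    (Finset.univ.filter fun π : Fin m → ZMod M => hits (circOccupied b) π ∈ B).card =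
      (Finset.univ.filter fun π : Fin m → ZMod M => hits (circOccupied b') π ∈ B).card := by
  -- The sizes of the targets are the same for both coin sequences, and they determine the number of
  -- vectors with `j` hits.
  have hj (j : ℕ) : (Finset.univ.filter fun π : Fin m → ZMod M =>
        hits (circOccupied b) π = j).card =
      (Finset.univ.filter fun π : Fin m → ZMod M => hits (circOccupied b') π = j).card := by
    apply Nat.cast_injective (R := ℤ)
    rw [card_hits_eq (circOccupied b) id m
        (fun i hi π => card_circOccupied b i (by omega) π) j,
      card_hits_eq (circOccupied b') id m
        (fun i hi π => card_circOccupied b' i (by omega) π) j]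
  have hdecomp (c : ℕ → Bool) :
      (Finset.univ.filter fun π : Fin m → ZMod M => hits (circOccupied c) π ∈ B).card =
      ∑ j ∈ (Finset.range (m + 1)).filter (· ∈ B),
        (Finset.univ.filter fun π : Fin m → ZMod M => hits (circOccupied c) π = j).card := by
    rw [Finset.card_eq_sum_card_fiberwise (f := hits (circOccupied c))
      (t := (Finset.range (m + 1)).filter (· ∈ B))]
    · refine Finset.sum_congr rfl fun j hj => ?_
      rw [Finset.filter_filter]
      congr 1
      ext π
      simp only [Finset.mem_filter, Finset.mem_univ, true_and]
      exact ⟨fun h => h.2, fun h => ⟨h ▸ (Finset.mem_filter.1 hj).2, h⟩⟩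
    · intro π hπ
      simpa [Nat.lt_succ_iff, hits_le] using hπ
  rw [hdecomp b, hdecomp b']
  exact Finset.sum_congr rfl fun j _ => hj j

open Classical in
lemma parkingLaw_real_unlucky {p : unitInterval} {r k m M : ℕ} [NeZero M] (hr : 1 ≤ r)
    (hk : 0 < k) (hN : streetLength r k m + r = M) (hM : k + m * r = M) (hmM : m ≤ M)
    (B : Set ℕ) :
    (parkingLaw p r k m).real {ω | unlucky ω ∈ B} =
      ((Finset.univ.filter fun π : Fin m → ZMod M =>
        hits (circOccupied fun _ => true) π ∈ B).card : ℝ) / (M : ℝ) ^ m := by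
  refine parkingLaw_real_eq hr hk hN hM hmM _ (fun b π => hits (circOccupied b) π ∈ B)
    (fun b π c => by rw [hits_circOccupied_add]) (fun ω hω => ?_)
    (fun b => card_hits_circOccupied_mem m hmM b _ B)
  obtain ⟨hcard, -⟩ := hω
  rw [Set.mem_ofPred_eq, unlucky_eq_hits _ ω hcard]

lemma parkingLaw_real_repeats {p : unitInterval} {r k m M : ℕ} [NeZero M] (hr : 1 ≤ r)
    (hk : 0 < k) (hN : streetLength r k m + r = M) (hM : k + m * r = M) (hmM : m ≤ M) (j : ℕ) :
    (parkingLaw p r k m).real {ω | repeats ω = j} =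
      ((Finset.univ.filter fun π : Fin m → ZMod M => hits lastEntry π = j).card : ℝ) /
        (M : ℝ) ^ m := by
  refine parkingLaw_real_eq hr hk hN hM hmM _ (fun _ π => hits lastEntry π = j)
    (fun b π c => by rw [hits_lastEntry_add]) (fun ω _ => ?_) (fun b => ?_)
  · rw [Set.mem_ofPred_eq, repeats_eq_hits]
  · congr

end RKParking

/-! ### Conclusion -/

theorem mainTheorem12 (p : unitInterval) (r : ℕ) (hr : 1 ≤ r) (c : ℝ) (hc : 0 ≤ c)
    (m k : ℕ → ℕ) (hm : Tendsto m atTop atTop) (hk : ∀ n, (k n : ℝ) = c * (m n : ℝ) + (r : ℝ)) :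
    (∀ j : ℕ,
      Tendsto
        (fun n => (RKParking.parkingLaw p r (k n) (m n)).real {ω | RKParking.repeats ω = j})
        atTop
        (𝓝 ((1 / (c + r)) ^ j * Real.exp (-(1 / (c + r))) / (Nat.factorial j : ℝ)))) ∧
    (∀ x : ℝ,
      Tendsto
        (fun n => (RKParking.parkingLaw p r (k n) (m n)).real
          {ω | ((RKParking.unlucky ω : ℝ) - 1 / (2 * (c + r)) * (m n : ℝ)) /
              Real.sqrt ((3 * (c + r) - 2) / (6 * (c + r) ^ 2) * (m n : ℝ)) ≤ x})
        atTop (𝓝 (cdf (gaussianReal 0 1) x))) := by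
  have hr' : (1 : ℝ) ≤ r := by exact_mod_cast hr
  have hA : 1 ≤ c + r := by linarith
  have hk0 (n : ℕ) : 0 < k n := by
    have : (0 : ℝ) < k n := by rw [hk]; positivity
    exact_mod_cast this
  have hM0 (n : ℕ) : NeZero (k n + m n * r) := ⟨by have := hk0 n; omega⟩
  have hmM (n : ℕ) : m n ≤ k n + m n * r := by
    have := Nat.mul_le_mul_left (m n) hr
    omega
  -- The form of `k` makes the circle length affine in `m`, with slope `A = c + r`.
  have hMR (n : ℕ) : ((k n + m n * r : ℕ) : ℝ) = (c + r) * m n + r := by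
    push_cast; rw [hk]; ring
  -- For `m n = 0` the truncated subtraction in `streetLength` would break this identity.
  have hN (n : ℕ) (hn : 1 ≤ m n) :
      RKParking.streetLength r (k n) (m n) + r = k n + m n * r := by
    rw [RKParking.streetLength]
    obtain ⟨l, hl⟩ := Nat.exists_eq_add_of_le' hn
    rw [hl, Nat.add_sub_cancel]
    ring
  constructor
  · intro j
    refine (RKParking.tendsto_repeats_limit (A := c + r) (r := r) (by linarith) m hm j).congr' ?_
    filter_upwards [hm.eventually_ge_atTop 1] with n hn
    rw [RKParking.parkingLaw_real_repeats hr (hk0 n) (hN n hn) rfl (hmM n)]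
    rw [RKParking.card_hits_lastEntry hn, hMR]
  · intro x
    set sd : ℕ → ℝ := fun n =>
      Real.sqrt ((3 * (c + r) - 2) / (6 * (c + r) ^ 2) * (m n : ℝ)) with hsd
    have h := RKParking.tendsto_card_le_cdf (Ω := fun n => Fin (m n) → ZMod (k n + m n * r))
      (fun n π => ((RKParking.hits (RKParking.circOccupied fun _ => true) π : ℝ) -
        1 / (2 * (c + r)) * (m n : ℝ)) / sd n) (fun t => ?_) x
    · refine h.congr' ?_
      filter_upwards [hm.eventually_ge_atTop 1] with n hn
      have := RKParking.parkingLaw_real_unlucky (p := p) hr (hk0 n) (hN n hn) rfl (hmM n)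
        {u : ℕ | ((u : ℝ) - 1 / (2 * (c + r)) * (m n : ℝ)) / sd n ≤ x}
      simp only [Set.mem_ofPred_eq] at this
      rw [this]
      simp
    · refine (RKParking.tendsto_charFun_bernoulli_sum (A := c + r) (r := r) hA (by linarith) hm t
        (fun n => t / sd n) (fun n => rfl)).congr fun n => ?_
      have := RKParking.sum_exp_hits_circOccupied (m n) (hmM n) (fun _ => true)
        (1 / (2 * (c + r)) * m n) (t / sd n)
      rw [hMR] at this
      rw [← this]
      congr 1
      refine Finset.sum_congr rfl fun π _ => ?_
      congr 1
      push_cast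
      ring
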